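/- For quantities $x,y$ and $\alpha\ge 1$ write $x\approx_\alpha y$ if $\frac1\alpha x\le y\le \alpha x$. Let $A$ be a real $n\times d$ matrix of full column rank with rows $a_1^T,\dots,a_n^T$. Its $\ell_1$ Lewis weights are the nonnegative weights $\bar w_1,\dots,\bar w_n$ such that, with $\bar W=\mathrm{diag}(\bar w)$, the matrix $A^T\bar W^{-1}A$ is invertible (zero rows, which have weight $0$, being omitted from it) and $a_i^T(A^T\bar W^{-1}A)^{-1}a_i=\bar w_i^2$ for every $i$. Given sampling values $p_1,\dots,p_n\ge 0$ whose sum $N=\sum_i p_i$ is a positive integer, let $S$ be the random $N\times n$ matrix whose rows are chosen independently, each being $\frac1{p_i}$ times the $i$-th standard basis vector with probability $\frac{p_i}{N}$. (1) For every $c>0$ there is a constant $C_s>0$, depending only on $c$, such that for every such $A$, every $0<\epsilon\le 1$ and all sampling values $p_i$ with $\sum_i p_i=N$ a positive integer and $$p_i\ \ge\ C_s\,\bar w_i\,\log(N)\,\epsilon^{-2}\qquad\text{for all } i,$$ with probability at least $1-N^{-c}$ one has $\|SAx\|_1\approx_{1+\epsilon}\|Ax\|_1$ for all $x\in\mathbb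 R^d$ simultaneously. (2) In particular, $O(d\log(d/\epsilon)\epsilon^{-2})$ row samples suffice, given constant-factor approximations to the Lewis weights: for every $c>0$ and $\alpha\ge1$ there is a constant $K>0$, depending only on $c$ and $\alpha$, such that for every such $A$, every $0<\epsilon\le1$ with $d/\epsilon\ge 2$, all weights $w'$ with $\bar w_i\approx_\alpha w'_i$ for all $i$, and every integer $N\ge K\,d\log(d/\epsilon)\,\epsilon^{-2}$, sampling $N$ rows as above with $p_i=N w'_i/\sum_j w'_j$ gives, with probability at least $1-N^{-c}$, $\|SAx\|_1\approx_{1+\epsilon}\|Ax\|_1$ for all $x\in\mathbb R^d$ simultaneously. -/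

import Mathlib

open MeasureTheory ProbabilityTheory
open scoped Matrix

noncomputable section

/-- `x ≈_α y`: the quantities `x` and `y` agree up to the factor `α`. -/
def ApproxFactor (α x y : ℝ) : Prop :=
  1 / α * x ≤ y ∧ y ≤ α * x

/-- The `ℓ₁` norm of a vector. -/
def l1norm {m : ℕ} (v : Fin m → ℝ) : ℝ :=
  ‖WithLp.toLp 1 v‖

/-- The quadratic form `Aᵀ W⁻¹ A` attached to a matrix `A` and weights `w`, with `W = diag w`.
A row of weight `0` contributes nothing (`0⁻¹ = 0`). -/
def lewisForm {n d : ℕ} (A : Matrix (Fin n) (Fin d) ℝ) (w : Fin n → ℝ) :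
    Matrix (Fin d) (Fin d) ℝ :=
  Aᵀ * Matrix.diagonal (fun i => (w i)⁻¹) * A

/-- `w` are the `ℓ₁` Lewis weights of `A`: nonnegative weights for which `Aᵀ W⁻¹ A` is invertible
and `aᵢᵀ (Aᵀ W⁻¹ A)⁻¹ aᵢ = wᵢ²` for every row `aᵢ` of `A`.

Invertibility is what the formula presupposes; it excludes the spurious solution `w = 0`, it forces
`A` to have full column rank, and together with the equation it makes `w i = 0` happen exactly at
the zero rows of `A`. -/
structure IsL1LewisWeights {n d : ℕ} (A : Matrix (Fin n) (Fin d) ℝ) (w : Fin n → ℝ) : Prop where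
  nonneg : ∀ i, 0 ≤ w i
  isUnit_det : IsUnit (lewisForm A w).det
  row_eq : ∀ i, A i ⬝ᵥ ((lewisForm A w)⁻¹ *ᵥ A i) = w i ^ 2

/-- `idx 0, …, idx (N - 1)` are independent random row indices, each equal to `i` with probability
`p i / N`. -/
structure IsRowSampling {Ω : Type*} [MeasurableSpace Ω] {n N : ℕ} (μ : Measure Ω)
    (p : Fin n → ℝ) (idx : Fin N → Ω → Fin n) : Prop where
  measurable : ∀ k, Measurable (idx k)
  indep : iIndepFun idx μ
  law : ∀ k i, μ {ω | idx k ω = i} = ENNReal.ofReal (p i / N)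

/-- The matrix `S` whose `k`-th row is `1 / p i` times the `i`-th standard basis vector, where
`i = r k` is the `k`-th chosen row index. -/
def samplingMatrix {n N : ℕ} (p : Fin n → ℝ) (r : Fin N → Fin n) : Matrix (Fin N) (Fin n) ℝ :=
  Matrix.of fun k => Pi.single (r k) (1 / p (r k))

/-- `‖S A x‖₁ ≈_{1+ε} ‖A x‖₁` for all vectors `x`. -/
def PreservesL1 {n d N : ℕ} (ε : ℝ) (S : Matrix (Fin N) (Fin n) ℝ)
    (A : Matrix (Fin n) (Fin d) ℝ) : Prop :=
  ∀ x : Fin d → ℝ, ApproxFactor (1 + ε) (l1norm ((S * A) *ᵥ x)) (l1norm (A *ᵥ x))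

end

/-! The proof bounds a high even moment of the uniform deviation of the sampled norm over `‖Ax‖₁ ≤
1`, then applies Markov. Probabilities are finite sums over sample sequences. Symmetrization inserts
random signs, and the contraction principle removes the absolute values, leaving the linear process
`∑ k, σ_k (a_{r k} ⬝ x) / p_{r k}`.

For a fixed sample, stack `A` with its sampled, rescaled rows, and let `Q` be the resulting
Lewis-type quadratic form (`stackedWeight`). Since `Q` dominates `Aᵀ W⁻¹ A`, the quantity `aᵢᵀ Q⁻¹
aᵢ` is at most `wᵢ²`. Reproducing `x` through `Q⁻¹` writes the process as a nonnegative combination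
of at most `n` sign sums, up to signs. Each of these has variance at most `η`, where `w ≤ η p`
(`sum_sq_le`). The coefficients have total mass at most 1 plus the sampled norm, and are bounded by
`wⱼ` plus the sample count, which sum to `d + N`. Jensen and Khintchine then replace the supremum
over `x` by a sum, without chaining (`sum_ciSup_boolSign_pow_le`).

The sampled norm is itself at most 1 plus the deviation, so the moment `V` satisfies `V ≤ κ (4 ^ q +
V)`. With `q` of order `log N` and `η` of order `ε² / log N`, `κ ≤ 1/2` and the recursion closes.
The second claim follows from the first by solving `N ≥ β d log N / ε²` for `N`. -/

/-! ### Sign sums and Khintchine's inequality. -/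

/-- The sign `1` or `-1` encoded by a Boolean. -/
noncomputable def boolSign (b : Bool) : ℝ := if b then 1 else -1

theorem boolSign_true : boolSign true = 1 := rfl

theorem boolSign_false : boolSign false = -1 := rfl

theorem sum_pi_prod {N : ℕ} {κ : Type*} [Fintype κ] (f : Fin N → κ → ℝ) :
    ∑ r : Fin N → κ, ∏ k, f k (r k) = ∏ k, ∑ j, f k j := by
  classical
  rw [Finset.prod_univ_sum, Fintype.piFinset_univ]

/-- The exponential factors over coordinates into `2 cosh (c k)`, and `cosh y ≤ exp (y² / 2)`. -/
theorem sum_exp_boolSign_le {N : ℕ} (c : Fin N → ℝ) :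
    ∑ σ : Fin N → Bool, Real.exp (∑ k, boolSign (σ k) * c k)
      ≤ 2 ^ N * Real.exp ((∑ k, c k ^ 2) / 2) := by
  simp_rw [Real.exp_sum]
  rw [sum_pi_prod (fun k b => Real.exp (boolSign b * c k)), Finset.sum_div, Real.exp_sum]
  have h2 : (2 : ℝ) ^ N = ∏ _k : Fin N, (2 : ℝ) := by simp
  rw [h2, ← Finset.prod_mul_distrib]
  refine Finset.prod_le_prod (fun k _ => Finset.sum_nonneg fun b _ => (Real.exp_pos _).le) ?_
  intro k _
  have := Real.cosh_le_exp_half_sq (c k)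
  rw [Real.cosh_eq] at this
  simp [boolSign]
  linarith

/-- Khintchine's inequality for even moments. -/
theorem sum_boolSign_pow_le {N q : ℕ} (hq : 1 ≤ q) (c : Fin N → ℝ) {v : ℝ} (hv : 0 < v)
    (hc : ∑ k, c k ^ 2 ≤ v) :
    ∑ σ : Fin N → Bool, (∑ k, boolSign (σ k) * c k) ^ (2 * q)
      ≤ 2 ^ N * (2 * (2 * q * Real.exp 1 * v) ^ q) := by
  have hq0 : (0 : ℝ) < 2 * q := by positivity
  -- This scale makes the subgaussian factor `exp (t² v / 2)` equal to `e ^ q`.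
  set t : ℝ := √(2 * q / v) with ht
  have htsq : t ^ 2 = 2 * q / v := Real.sq_sqrt (by positivity)
  have htpos : 0 < t := Real.sqrt_pos.2 (by positivity)
  have hpt : ∀ y : ℝ, y ^ (2 * q) ≤ ((2 * q : ℝ) * v) ^ q *
      (Real.exp (t * y) + Real.exp (-(t * y))) := by
    intro y
    have h1 := Real.pow_div_factorial_le_exp |t * y| (abs_nonneg _) (2 * q)
    have h2 : Real.exp |t * y| ≤ Real.exp (t * y) + Real.exp (-(t * y)) := by
      rcases abs_cases (t * y) with ⟨h, _⟩ | ⟨h, _⟩ <;> rw [h] <;>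
        linarith [Real.exp_pos (t * y), Real.exp_pos (-(t * y))]
    have h3 : ((2 * q).factorial : ℝ) ≤ (2 * q : ℝ) ^ (2 * q) := by
      exact_mod_cast Nat.factorial_le_pow (2 * q)
    have hf : (0 : ℝ) < (2 * q).factorial := by positivity
    rw [div_le_iff₀ hf] at h1
    have h4 : |t * y| ^ (2 * q) = (2 * q / v) ^ q * y ^ (2 * q) := by
      rw [pow_mul, sq_abs, mul_pow, htsq, mul_pow, pow_mul]
    rw [h4] at h1
    have h5 : y ^ (2 * q) = (v / (2 * q)) ^ q * ((2 * q / v) ^ q * y ^ (2 * q)) := by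
      rw [← mul_assoc, ← mul_pow]
      rw [div_mul_div_cancel₀ hq0.ne', div_self hv.ne', one_pow, one_mul]
    rw [h5]
    have h6 : (2 * q / v) ^ q * y ^ (2 * q) ≤
        (Real.exp (t * y) + Real.exp (-(t * y))) * (2 * q : ℝ) ^ (2 * q) :=
      h1.trans (mul_le_mul h2 h3 hf.le (by positivity))
    have h7 : (v / (2 * q)) ^ q * (2 * q : ℝ) ^ (2 * q) = ((2 * q : ℝ) * v) ^ q := by
      rw [pow_mul, ← mul_pow]; congr 1; field_simp
    calc _ ≤ (v / (2 * q)) ^ q *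
          ((Real.exp (t * y) + Real.exp (-(t * y))) * (2 * q : ℝ) ^ (2 * q)) := by gcongr
      _ = _ := by rw [← h7]; ring
  have hexp : ∀ s : ℝ, s ^ 2 = t ^ 2 → ∑ σ : Fin N → Bool,
      Real.exp (s * ∑ k, boolSign (σ k) * c k) ≤ 2 ^ N * Real.exp 1 ^ q := by
    intro s hs
    have h := sum_exp_boolSign_le (fun k => s * c k)
    have e1 : ∀ σ : Fin N → Bool, ∑ k, boolSign (σ k) * (s * c k)
        = s * ∑ k, boolSign (σ k) * c k := fun σ => by
      rw [Finset.mul_sum]; exact Finset.sum_congr rfl fun k _ => by ring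
    simp_rw [e1, mul_pow, ← Finset.mul_sum, hs, htsq] at h
    refine h.trans ?_
    rw [← Real.exp_nat_mul]
    gcongr
    rw [div_mul_eq_mul_div, div_div, div_le_iff₀ (by positivity)]
    nlinarith
  calc _ ≤ ∑ σ : Fin N → Bool, ((2 * q : ℝ) * v) ^ q *
        (Real.exp (t * ∑ k, boolSign (σ k) * c k) +
          Real.exp ((-t) * ∑ k, boolSign (σ k) * c k)) := by
        refine Finset.sum_le_sum fun σ _ => ?_
        rw [neg_mul]; exact hpt _
    _ ≤ ((2 * q : ℝ) * v) ^ q * (2 ^ N * Real.exp 1 ^ q + 2 ^ N * Real.exp 1 ^ q) := by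
        rw [← Finset.mul_sum, Finset.sum_add_distrib]
        gcongr
        · exact hexp t rfl
        · exact hexp (-t) (by ring)
    _ = _ := by
        rw [show (2 * q * Real.exp 1 * v : ℝ) = (2 * q * v) * Real.exp 1 by ring, mul_pow]; ring

/-! ### Contraction: removing absolute values under random signs. -/

/-- Take maximizers `i` and `j` of the two suprema on the left. According to the sign of `t i`, the
term at `i` occurs unchanged in one supremum on the right; the term at `j` is bounded by the other,
since `-|t j|` is below both `t j` and `-t j`. -/
theorem ciSup_add_ciSup_abs_le {ι : Type*} [Finite ι] [Nonempty ι] {G : ℝ → ℝ}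
    (hG : Monotone G) (f t : ι → ℝ) :
    (⨆ i, G (f i + |t i|)) + (⨆ i, G (f i - |t i|))
      ≤ (⨆ i, G (f i + t i)) + (⨆ i, G (f i - t i)) := by
  obtain ⟨i, hi⟩ := exists_eq_ciSup_of_finite (f := fun i => G (f i + |t i|))
  obtain ⟨j, hj⟩ := exists_eq_ciSup_of_finite (f := fun i => G (f i - |t i|))
  rw [← hi, ← hj]
  have hp : ∀ k, G (f k + t k) ≤ ⨆ i, G (f i + t i) := fun k =>
    le_ciSup (f := fun i => G (f i + t i)) (Set.finite_range _).bddAbove k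
  have hm : ∀ k, G (f k - t k) ≤ ⨆ i, G (f i - t i) := fun k =>
    le_ciSup (f := fun i => G (f i - t i)) (Set.finite_range _).bddAbove k
  rcases le_total 0 (t i) with h | h
  · have h1 : G (f j - |t j|) ≤ G (f j - t j) := hG (by linarith [le_abs_self (t j)])
    have h2 := hp i
    simp only [abs_of_nonneg h]
    linarith [hm j]
  · have h1 : G (f j - |t j|) ≤ G (f j + t j) := hG (by linarith [neg_abs_le (t j)])
    have h2 := hm i
    simp only [abs_of_nonpos h]
    rw [← sub_eq_add_neg]
    linarith [hp j]

theorem sum_bool_cons {N : ℕ} (F : (Fin (N + 1) → Bool) → ℝ) :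
    ∑ σ, F σ = ∑ σ : Fin N → Bool, (F (Fin.cons true σ) + F (Fin.cons false σ)) := by
  rw [← (Fin.consEquiv fun _ => Bool).sum_comp, Fintype.sum_prod_type_right]
  simp [Fin.consEquiv]

/-- The contraction principle for the absolute value. -/
theorem sum_ciSup_abs_le {ι : Type*} [Finite ι] [Nonempty ι] {G : ℝ → ℝ} (hG : Monotone G) :
    ∀ {N : ℕ} (f : ι → ℝ) (t : Fin N → ι → ℝ),
      ∑ σ : Fin N → Bool, (⨆ i, G (f i + ∑ k, boolSign (σ k) * |t k i|))
        ≤ ∑ σ : Fin N → Bool, (⨆ i, G (f i + ∑ k, boolSign (σ k) * t k i)) := by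
  intro N
  induction N with
  | zero => intro f t; simp
  | succ N ih =>
    intro f t
    rw [sum_bool_cons, sum_bool_cons]
    simp only [Fin.sum_univ_succ, Fin.cons_zero, Fin.cons_succ]
    simp only [← add_assoc]
    -- The free offset `f` absorbs the coordinate 0 term, so induction treats the rest before the
    -- two-point inequality treats this one.
    calc _ ≤ ∑ σ : Fin N → Bool,
          ((⨆ i, G ((f i + boolSign true * |t 0 i|) + ∑ k, boolSign (σ k) * t k.succ i)) +
          (⨆ i, G ((f i + boolSign false * |t 0 i|) + ∑ k, boolSign (σ k) * t k.succ i))) := by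
          rw [Finset.sum_add_distrib, Finset.sum_add_distrib]
          exact add_le_add
            (ih (fun i => f i + boolSign true * |t 0 i|) fun k i => t k.succ i)
            (ih (fun i => f i + boolSign false * |t 0 i|) fun k i => t k.succ i)
      _ ≤ _ := by
          refine Finset.sum_le_sum fun σ _ => ?_
          have := ciSup_add_ciSup_abs_le hG
            (fun i => f i + ∑ k, boolSign (σ k) * t k.succ i) (t 0)
          simp only [boolSign_true, boolSign_false, one_mul, neg_mul]
          simpa only [sub_eq_add_neg, add_right_comm] using this

theorem sum_bool_not {N : ℕ} (F : (Fin N → Bool) → ℝ) :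
    ∑ σ : Fin N → Bool, F (fun k => !(σ k)) = ∑ σ, F σ :=
  (Equiv.piCongrRight fun _ : Fin N => Equiv.boolNot).sum_comp F

/-- Even powers are not monotone, so contraction is applied to the power of the positive part. The
negative part has the same sum after flipping all signs, whence the factor 2. -/
theorem sum_ciSup_abs_pow_le {ι : Type*} [Finite ι] [Nonempty ι] {N q : ℕ} (hq : 1 ≤ q)
    (t : Fin N → ι → ℝ) :
    ∑ σ : Fin N → Bool, (⨆ i, (∑ k, boolSign (σ k) * |t k i|) ^ (2 * q))
      ≤ 2 * ∑ σ : Fin N → Bool, (⨆ i, (∑ k, boolSign (σ k) * t k i) ^ (2 * q)) := by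
  set G : ℝ → ℝ := fun y => (max y 0) ^ (2 * q) with hGdef
  have hG : Monotone G := fun a b hab =>
    pow_le_pow_left₀ (le_max_right _ _) (max_le_max_right 0 hab) _
  have hG0 : ∀ y, 0 ≤ G y := fun y => pow_nonneg (le_max_right _ _) _
  have hGle : ∀ y, G y ≤ y ^ (2 * q) := by
    intro y
    rcases le_total 0 y with h | h
    · simp [G, max_eq_left h]
    · simp only [G, max_eq_right h]
      rw [zero_pow (by omega)]; rw [pow_mul]; positivity
  have hbd : ∀ F : ι → ℝ, BddAbove (Set.range F) := fun F => (Set.finite_range F).bddAbove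
  have hsplit : ∀ F : ι → ℝ, (⨆ i, F i ^ (2 * q)) ≤ (⨆ i, G (F i)) + ⨆ i, G (-F i) := by
    intro F
    refine ciSup_le fun i => ?_
    have h1 := le_ciSup (hbd fun i => G (F i)) i
    have h2 := le_ciSup (hbd fun i => G (-F i)) i
    have h3 : F i ^ (2 * q) ≤ G (F i) + G (-F i) := by
      rcases le_total 0 (F i) with h | h
      · have : F i ^ (2 * q) = G (F i) := by simp [G, max_eq_left h]
        linarith [hG0 (-F i)]
      · have : F i ^ (2 * q) = G (-F i) := by
          simp only [G, max_eq_left (neg_nonneg.2 h)]; rw [pow_mul, pow_mul, neg_sq]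
        linarith [hG0 (F i)]
    linarith
  have hc := sum_ciSup_abs_le hG (fun _ => 0) t
  simp only [zero_add] at hc
  have hneg : ∑ σ : Fin N → Bool, (⨆ i, G (-∑ k, boolSign (σ k) * |t k i|))
      = ∑ σ : Fin N → Bool, (⨆ i, G (∑ k, boolSign (σ k) * |t k i|)) := by
    rw [← sum_bool_not]
    refine Finset.sum_congr rfl fun σ _ => ?_
    congr 1; funext i; congr 1
    rw [← Finset.sum_neg_distrib]
    refine Finset.sum_congr rfl fun k _ => ?_
    cases h : σ k <;> simp [boolSign, h]
  calc _ ≤ ∑ σ : Fin N → Bool, ((⨆ i, G (∑ k, boolSign (σ k) * |t k i|)) +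
        ⨆ i, G (-∑ k, boolSign (σ k) * |t k i|)) := Finset.sum_le_sum fun σ _ => hsplit _
    _ = 2 * ∑ σ : Fin N → Bool, (⨆ i, G (∑ k, boolSign (σ k) * |t k i|)) := by
        rw [Finset.sum_add_distrib, hneg]; ring
    _ ≤ 2 * ∑ σ : Fin N → Bool, (⨆ i, G (∑ k, boolSign (σ k) * t k i)) := by linarith
    _ ≤ _ := by
        refine mul_le_mul_of_nonneg_left (Finset.sum_le_sum fun σ _ => ?_) zero_le_two
        exact ciSup_mono (hbd _) fun i => hGle _

/-! ### Independent samples and symmetrization. -/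

theorem sum_prod_eq_one {N : ℕ} {κ : Type*} [Fintype κ] {P : κ → ℝ} (hP : ∑ j, P j = 1) :
    ∑ r : Fin N → κ, ∏ k, P (r k) = 1 := by
  rw [sum_pi_prod (fun _ => P)]; simp [hP]

/-- The mean of a sum of functions of independent samples. -/
theorem sum_prod_mul_sum {κ : Type*} [Fintype κ] {P : κ → ℝ} (hP : ∑ j, P j = 1) (h : κ → ℝ) :
    ∀ N : ℕ, ∑ r : Fin N → κ, (∏ k, P (r k)) * ∑ k, h (r k) = N * ∑ j, P j * h j := by
  intro N
  induction N with
  | zero => simp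
  | succ N ih =>
    rw [← (Fin.consEquiv fun _ => κ).sum_comp, Fintype.sum_prod_type]
    simp only [Fin.consEquiv_apply, Fin.prod_univ_succ, Fin.sum_univ_succ, Fin.cons_zero,
      Fin.cons_succ]
    have e : ∀ j, ∑ r : Fin N → κ, P j * (∏ k, P (r k)) * (h j + ∑ k, h (r k))
        = P j * h j + P j * (N * ∑ j, P j * h j) := by
      intro j
      rw [← ih, Finset.mul_sum]
      calc _ = P j * h j * ∑ r : Fin N → κ, (∏ k, P (r k)) +
            ∑ r : Fin N → κ, P j * ((∏ k, P (r k)) * ∑ k, h (r k)) := by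
            rw [Finset.mul_sum, ← Finset.sum_add_distrib]
            exact Finset.sum_congr rfl fun r _ => by ring
        _ = _ := by rw [sum_prod_eq_one hP, mul_one]
    simp_rw [e]
    rw [Finset.sum_add_distrib, ← Finset.sum_mul, hP]
    push_cast; ring

/-- Exchange the entries of two sample sequences at the places where `σ` is `false`. -/
def swapEquiv {N : ℕ} {κ : Type*} (σ : Fin N → Bool) :
    ((Fin N → κ) × (Fin N → κ)) ≃ ((Fin N → κ) × (Fin N → κ)) where
  toFun x := (fun k => if σ k then x.1 k else x.2 k, fun k => if σ k then x.2 k else x.1 k)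
  invFun x := (fun k => if σ k then x.1 k else x.2 k, fun k => if σ k then x.2 k else x.1 k)
  left_inv x := by
    ext k <;> by_cases h : σ k <;> simp [h]
  right_inv x := by
    ext k <;> by_cases h : σ k <;> simp [h]

/-- Exchanging entries between two independent copies preserves the product weight and flips the
sign of exactly the exchanged differences. -/
theorem sum_sum_ciSup_swap {N : ℕ} {κ ι : Type*} [Fintype κ] (P : κ → ℝ) (h : ι → κ → ℝ) (l : ℕ)
    (σ : Fin N → Bool) :
    ∑ x : (Fin N → κ) × (Fin N → κ), (∏ k, P (x.1 k)) * (∏ k, P (x.2 k)) *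
        ⨆ i, (∑ k, (h i (x.1 k) - h i (x.2 k))) ^ l
      = ∑ x : (Fin N → κ) × (Fin N → κ), (∏ k, P (x.1 k)) * (∏ k, P (x.2 k)) *
        ⨆ i, (∑ k, boolSign (σ k) * (h i (x.1 k) - h i (x.2 k))) ^ l := by
  rw [← (swapEquiv σ).sum_comp]
  refine Finset.sum_congr rfl fun x _ => ?_
  congr 1
  · rw [← Finset.prod_mul_distrib, ← Finset.prod_mul_distrib]
    refine Finset.prod_congr rfl fun k _ => ?_
    by_cases hk : σ k <;> simp [swapEquiv, hk, mul_comm]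
  · congr 1; funext i; congr 1
    refine Finset.sum_congr rfl fun k _ => ?_
    by_cases hk : σ k <;> simp [swapEquiv, hk, boolSign]

/-- Symmetrization for even moments of the supremum of a finite empirical process. -/
theorem symmetrization {N q : ℕ} (hq : 1 ≤ q) {κ ι : Type*} [Fintype κ] [Finite ι] [Nonempty ι]
    {P : κ → ℝ} (hP0 : ∀ j, 0 ≤ P j) (hP : ∑ j, P j = 1) (h : ι → κ → ℝ) :
    2 ^ N * ∑ r : Fin N → κ, (∏ k, P (r k)) *
        (⨆ i, (∑ k, h i (r k) - N * ∑ j, P j * h i j) ^ (2 * q))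
      ≤ 2 ^ (2 * q) * ∑ r : Fin N → κ, (∏ k, P (r k)) *
        ∑ σ : Fin N → Bool, ⨆ i, (∑ k, boolSign (σ k) * h i (r k)) ^ (2 * q) := by
  have hbd : ∀ F : ι → ℝ, BddAbove (Set.range F) := fun F => (Set.finite_range F).bddAbove
  have hρ : ∀ r : Fin N → κ, 0 ≤ ∏ k, P (r k) := fun r => Finset.prod_nonneg fun k _ => hP0 _
  have hev : Even (2 * q) := even_two_mul q
  have hl : 2 * q - 1 + 1 = 2 * q := by omega
  -- The mean is realized by an independent copy `r'`, and Jensen moves the even power inside the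
  -- average over it.
  have hjensen : ∀ r : Fin N → κ,
      (⨆ i, (∑ k, h i (r k) - N * ∑ j, P j * h i j) ^ (2 * q)) ≤
      ∑ r' : Fin N → κ, (∏ k, P (r' k)) * ⨆ i, (∑ k, (h i (r k) - h i (r' k))) ^ (2 * q) := by
    intro r
    refine ciSup_le fun i => ?_
    have e : ∑ k, h i (r k) - N * ∑ j, P j * h i j =
        ∑ r' : Fin N → κ, (∏ k, P (r' k)) * ∑ k, (h i (r k) - h i (r' k)) := by
      simp_rw [Finset.sum_sub_distrib, mul_sub]
      rw [Finset.sum_sub_distrib, sum_prod_mul_sum hP, ← Finset.sum_mul, sum_prod_eq_one hP,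
        one_mul]
    rw [e]
    refine (Real.pow_arith_mean_le_arith_mean_pow_of_even Finset.univ _ _ (fun r' _ => hρ r')
      (sum_prod_eq_one hP) hev).trans ?_
    refine Finset.sum_le_sum fun r' _ => mul_le_mul_of_nonneg_left ?_ (hρ r')
    exact le_ciSup (hbd fun i => (∑ k, (h i (r k) - h i (r' k))) ^ (2 * q)) i
  set S : (Fin N → κ) → (Fin N → Bool) → ℝ := fun r σ =>
    ⨆ i, (∑ k, boolSign (σ k) * h i (r k)) ^ (2 * q) with hS
  have hsplit : ∀ (σ : Fin N → Bool) (r r' : Fin N → κ),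
      (⨆ i, (∑ k, boolSign (σ k) * (h i (r k) - h i (r' k))) ^ (2 * q)) ≤
      2 ^ (2 * q - 1) * (S r σ + S r' σ) := by
    intro σ r r'
    refine ciSup_le fun i => ?_
    have h1 := le_ciSup (hbd fun i => (∑ k, boolSign (σ k) * h i (r k)) ^ (2 * q)) i
    have h2 := le_ciSup (hbd fun i => (∑ k, boolSign (σ k) * h i (r' k)) ^ (2 * q)) i
    have h3 := add_pow_le (abs_nonneg (∑ k, boolSign (σ k) * h i (r k)))
      (abs_nonneg (∑ k, boolSign (σ k) * h i (r' k))) (2 * q)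
    rw [hev.pow_abs, hev.pow_abs] at h3
    simp_rw [mul_sub]
    rw [Finset.sum_sub_distrib, ← hev.pow_abs]
    calc _ ≤ (|∑ k, boolSign (σ k) * h i (r k)| + |∑ k, boolSign (σ k) * h i (r' k)|) ^ (2 * q) := by
          gcongr; exact abs_sub _ _
      _ ≤ _ := h3
      _ ≤ _ := by gcongr
  calc _ ≤ 2 ^ N * ∑ r : Fin N → κ, (∏ k, P (r k)) * ∑ r' : Fin N → κ, (∏ k, P (r' k)) *
        ⨆ i, (∑ k, (h i (r k) - h i (r' k))) ^ (2 * q) := by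
        gcongr with r _
        · exact hρ r
        · exact hjensen r
    _ = 2 ^ N * ∑ x : (Fin N → κ) × (Fin N → κ), (∏ k, P (x.1 k)) * (∏ k, P (x.2 k)) *
        ⨆ i, (∑ k, (h i (x.1 k) - h i (x.2 k))) ^ (2 * q) := by
        rw [Fintype.sum_prod_type]
        simp_rw [Finset.mul_sum, mul_assoc]
    _ = ∑ σ : Fin N → Bool, ∑ x : (Fin N → κ) × (Fin N → κ), (∏ k, P (x.1 k)) *
        (∏ k, P (x.2 k)) *
        ⨆ i, (∑ k, boolSign (σ k) * (h i (x.1 k) - h i (x.2 k))) ^ (2 * q) := by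
        simp_rw [← sum_sum_ciSup_swap P h (2 * q)]
        simp
    _ ≤ ∑ σ : Fin N → Bool, ∑ x : (Fin N → κ) × (Fin N → κ), (∏ k, P (x.1 k)) *
        (∏ k, P (x.2 k)) * (2 ^ (2 * q - 1) * (S x.1 σ + S x.2 σ)) := by
        gcongr with σ _ x _
        · exact mul_nonneg (hρ _) (hρ _)
        · exact hsplit _ _ _
    _ = ∑ σ : Fin N → Bool, 2 ^ (2 * q) * ∑ r : Fin N → κ, (∏ k, P (r k)) * S r σ := by
        refine Finset.sum_congr rfl fun σ _ => ?_
        have h1 : ∑ x : (Fin N → κ) × (Fin N → κ), (∏ k, P (x.1 k)) * (∏ k, P (x.2 k)) * S x.1 σ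
            = ∑ r : Fin N → κ, (∏ k, P (r k)) * S r σ := by
          rw [Fintype.sum_prod_type]
          refine Finset.sum_congr rfl fun r _ => ?_
          dsimp only
          rw [← Finset.sum_mul, ← Finset.mul_sum, sum_prod_eq_one hP, mul_one]
        have h2 : ∑ x : (Fin N → κ) × (Fin N → κ), (∏ k, P (x.1 k)) * (∏ k, P (x.2 k)) * S x.2 σ
            = ∑ r : Fin N → κ, (∏ k, P (r k)) * S r σ := by
          rw [Fintype.sum_prod_type_right]
          refine Finset.sum_congr rfl fun r _ => ?_
          dsimp only
          rw [← Finset.sum_mul, ← Finset.sum_mul, sum_prod_eq_one hP, one_mul]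
        rw [← hl, pow_succ, Nat.add_sub_cancel]
        calc _ = 2 ^ (2 * q - 1) * (∑ x : (Fin N → κ) × (Fin N → κ),
              (∏ k, P (x.1 k)) * (∏ k, P (x.2 k)) * S x.1 σ + ∑ x : (Fin N → κ) × (Fin N → κ),
              (∏ k, P (x.1 k)) * (∏ k, P (x.2 k)) * S x.2 σ) := by
              rw [← Finset.sum_add_distrib, Finset.mul_sum]
              exact Finset.sum_congr rfl fun x _ => by ring
          _ = _ := by rw [h1, h2]; ring
    _ = _ := by
        rw [← Finset.mul_sum, Finset.sum_comm]
        simp_rw [Finset.mul_sum]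
        rfl

/-! ### Quadratic forms and basic properties of Lewis weights. -/

section Gram

variable {n d : ℕ} (A : Matrix (Fin n) (Fin d) ℝ)

theorem transpose_mul_diagonal_mul_mulVec (v : Fin n → ℝ) (y : Fin d → ℝ) :
    (Aᵀ * Matrix.diagonal v * A) *ᵥ y = Aᵀ *ᵥ fun i => v i * (A i ⬝ᵥ y) := by
  rw [← Matrix.mulVec_mulVec, ← Matrix.mulVec_mulVec]
  congr 1
  funext i
  rw [Matrix.mulVec_diagonal]; rfl

theorem dotProduct_gram_mulVec (v : Fin n → ℝ) (x y : Fin d → ℝ) :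
    x ⬝ᵥ ((Aᵀ * Matrix.diagonal v * A) *ᵥ y) = ∑ i, v i * ((A i ⬝ᵥ x) * (A i ⬝ᵥ y)) := by
  rw [transpose_mul_diagonal_mul_mulVec, Matrix.dotProduct_mulVec, Matrix.vecMul_transpose]
  simp only [dotProduct, Matrix.mulVec]
  exact Finset.sum_congr rfl fun i _ => by ring

end Gram

namespace IsL1LewisWeights

variable {n d : ℕ} {A : Matrix (Fin n) (Fin d) ℝ} {w : Fin n → ℝ}

/-- Cauchy–Schwarz for the form `M = Aᵀ W⁻¹ A`: with `z = M⁻¹ aᵢ`, the number `aᵢ ⬝ x` is the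
`M`-pairing of `x` and `z`, and `z` has squared `M`-norm `wᵢ²`. -/
theorem dotProduct_sq_le (h : IsL1LewisWeights A w) (i : Fin n) (x : Fin d → ℝ) :
    (A i ⬝ᵥ x) ^ 2 ≤ w i ^ 2 * ∑ j, (w j)⁻¹ * (A j ⬝ᵥ x) ^ 2 := by
  set z := (lewisForm A w)⁻¹ *ᵥ A i with hz
  have hMz : lewisForm A w *ᵥ z = A i := by
    rw [hz, Matrix.mulVec_mulVec, Matrix.mul_nonsing_inv _ h.isUnit_det, Matrix.one_mulVec]
  have e : ∀ y : Fin d → ℝ, A i ⬝ᵥ y = ∑ j, (w j)⁻¹ * ((A j ⬝ᵥ y) * (A j ⬝ᵥ z)) := by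
    intro y
    rw [← dotProduct_gram_mulVec A (fun j => (w j)⁻¹) y z, dotProduct_comm]
    congr 1
    exact hMz.symm
  have hw : w i ^ 2 = ∑ j, (w j)⁻¹ * (A j ⬝ᵥ z) ^ 2 := by
    rw [← h.row_eq i, ← hz, e z]
    simp only [sq]
  rw [hw, mul_comm, e x]
  refine Finset.sum_sq_le_sum_mul_sum_of_sq_le_mul _ (fun j _ => ?_) (fun j _ => ?_)
    fun j _ => le_of_eq (by ring)
  · exact mul_nonneg (inv_nonneg.2 (h.nonneg j)) (sq_nonneg _)
  · exact mul_nonneg (inv_nonneg.2 (h.nonneg j)) (sq_nonneg _)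

theorem dotProduct_eq_zero (h : IsL1LewisWeights A w) {i : Fin n} (hi : w i = 0)
    (x : Fin d → ℝ) : A i ⬝ᵥ x = 0 := by
  have := h.dotProduct_sq_le i x
  rw [hi] at this
  simp only [ne_eq, OfNat.ofNat_ne_zero, not_false_eq_true, zero_pow, zero_mul] at this
  exact pow_eq_zero_iff two_ne_zero |>.1 (le_antisymm this (sq_nonneg _))

/-- Writing `Q` for the left side, Cauchy–Schwarz gives `|aⱼ ⬝ x| ≤ wⱼ √Q`. Using this for one of
the two factors in each square yields `Q ≤ ‖Ax‖₁ √Q`. -/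
theorem sum_inv_mul_sq_le (h : IsL1LewisWeights A w) (x : Fin d → ℝ) :
    ∑ j, (w j)⁻¹ * (A j ⬝ᵥ x) ^ 2 ≤ (∑ j, |A j ⬝ᵥ x|) ^ 2 := by
  set Q := ∑ j, (w j)⁻¹ * (A j ⬝ᵥ x) ^ 2 with hQ
  have hQ0 : 0 ≤ Q := Finset.sum_nonneg fun j _ =>
    mul_nonneg (inv_nonneg.2 (h.nonneg j)) (sq_nonneg _)
  have hb : ∀ j, |A j ⬝ᵥ x| ≤ w j * √Q := fun j => by
    refine abs_le_of_sq_le_sq ?_ (mul_nonneg (h.nonneg j) (Real.sqrt_nonneg _))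
    rw [mul_pow, Real.sq_sqrt hQ0]
    exact h.dotProduct_sq_le j x
  have h1 : Q ≤ (∑ j, |A j ⬝ᵥ x|) * √Q := by
    rw [Finset.sum_mul, hQ]
    refine Finset.sum_le_sum fun j _ => ?_
    rcases (h.nonneg j).eq_or_lt with h0 | h0
    · rw [← h0]; simp only [inv_zero, zero_mul]; positivity
    · rw [← sq_abs, inv_mul_le_iff₀ h0, sq]
      nlinarith [hb j, abs_nonneg (A j ⬝ᵥ x)]
  have hs : 0 ≤ ∑ j, |A j ⬝ᵥ x| := Finset.sum_nonneg fun j _ => abs_nonneg _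
  have h2 : √Q ≤ ∑ j, |A j ⬝ᵥ x| := by
    rcases (Real.sqrt_nonneg Q).eq_or_lt with h0 | h0
    · rw [← h0]; exact hs
    · refine le_of_mul_le_mul_right ?_ h0
      rwa [Real.mul_self_sqrt hQ0]
  calc Q = √Q ^ 2 := (Real.sq_sqrt hQ0).symm
    _ ≤ _ := by gcongr

theorem abs_dotProduct_le (h : IsL1LewisWeights A w) (i : Fin n) (x : Fin d → ℝ) :
    |A i ⬝ᵥ x| ≤ w i * ∑ j, |A j ⬝ᵥ x| := by
  have hs : 0 ≤ ∑ j, |A j ⬝ᵥ x| := Finset.sum_nonneg fun j _ => abs_nonneg _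
  refine abs_le_of_sq_le_sq ?_ (mul_nonneg (h.nonneg i) hs)
  rw [mul_pow]
  exact (h.dotProduct_sq_le i x).trans
    (mul_le_mul_of_nonneg_left (h.sum_inv_mul_sq_le x) (sq_nonneg _))

/-- The Lewis weights sum to the dimension. -/
theorem sum_eq (h : IsL1LewisWeights A w) : ∑ i, w i = d := by
  have h1 : ∀ i, w i = (w i)⁻¹ * (A * ((lewisForm A w)⁻¹ * Aᵀ)) i i := by
    intro i
    have e : (A * ((lewisForm A w)⁻¹ * Aᵀ)) i i = w i ^ 2 := by
      rw [← h.row_eq i, Matrix.mul_apply]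
      simp only [dotProduct, Matrix.mulVec, Matrix.mul_apply, Matrix.transpose_apply]
    rw [e]
    rcases eq_or_ne (w i) 0 with h0 | h0
    · simp [h0]
    · field_simp
  -- Cyclicity of the trace turns the sum into the trace of the `d × d` identity.
  calc ∑ i, w i = (Matrix.diagonal (fun i => (w i)⁻¹) *
        (A * ((lewisForm A w)⁻¹ * Aᵀ))).trace := by
        rw [Matrix.trace]
        refine Finset.sum_congr rfl fun i _ => ?_
        rw [Matrix.diag_apply, Matrix.diagonal_mul]
        exact h1 i
    _ = (lewisForm A w * (lewisForm A w)⁻¹).trace := by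
        rw [← Matrix.mul_assoc, ← Matrix.mul_assoc, Matrix.trace_mul_comm, ← Matrix.mul_assoc,
          ← Matrix.mul_assoc, lewisForm]
    _ = d := by rw [Matrix.mul_nonsing_inv _ h.isUnit_det, Matrix.trace_one, Fintype.card_fin]

end IsL1LewisWeights

/-! ### The sign process of a fixed sample. -/

/-- Jensen for the normalized weights gives the factor `s ^ (l - 1)`, where `s` is their total; `1 ≤
B` allows it to be rounded up to `B ^ l`. -/
theorem sum_mul_pow_le_of_sum_le {ι : Type*} [Fintype ι] {ω c : ι → ℝ} {B : ℝ} {l : ℕ}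
    (hω : ∀ i, 0 ≤ ω i) (hc : ∀ i, 0 ≤ c i) (hB1 : 1 ≤ B) (hB : ∑ i, ω i ≤ B) (hl : l ≠ 0) :
    (∑ i, ω i * c i) ^ l ≤ B ^ l * ∑ i, ω i * c i ^ l := by
  set s := ∑ i, ω i with hs
  have hs0 : 0 ≤ s := Finset.sum_nonneg fun i _ => hω i
  have hB0 : 0 ≤ B := zero_le_one.trans hB1
  have hr : 0 ≤ ∑ i, ω i * c i ^ l :=
    Finset.sum_nonneg fun i _ => mul_nonneg (hω i) (pow_nonneg (hc i) _)
  rcases hs0.eq_or_lt with h0 | h0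
  · have : ∀ i, ω i = 0 := fun i =>
      (Finset.sum_eq_zero_iff_of_nonneg fun i _ => hω i).1 h0.symm i (Finset.mem_univ i)
    simp [this, hl]
  · have h := Real.pow_arith_mean_le_arith_mean_pow Finset.univ (fun i => ω i / s) c
      (fun i _ => div_nonneg (hω i) hs0) (by rw [← Finset.sum_div, ← hs, div_self h0.ne'])
      (fun i _ => hc i) l
    have e1 : ∀ f : ι → ℝ, ∑ i, ω i / s * f i = (∑ i, ω i * f i) / s := fun f => by
      rw [Finset.sum_div]; exact Finset.sum_congr rfl fun i _ => by ring
    rw [e1, e1, div_pow, div_le_iff₀ (by positivity)] at h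
    refine h.trans ?_
    obtain ⟨m, rfl⟩ := Nat.exists_eq_succ_of_ne_zero hl
    have h2 : s ^ m ≤ B ^ (m + 1) :=
      (pow_le_pow_left₀ hs0 hB m).trans (pow_le_pow_right₀ hB1 m.le_succ)
    calc _ = s ^ m * ∑ i, ω i * c i ^ (m + 1) := by
          rw [Nat.succ_eq_add_one, pow_succ]; field_simp
      _ ≤ _ := mul_le_mul_of_nonneg_right h2 hr

/-- How often the index `i` was chosen. -/
def sampleCount {n N : ℕ} (r : Fin N → Fin n) (i : Fin n) : ℝ :=
  ∑ k, if r k = i then 1 else 0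

theorem sum_comp_eq_sum_sampleCount {n N : ℕ} (r : Fin N → Fin n) (f : Fin n → ℝ) :
    ∑ k, f (r k) = ∑ i, sampleCount r i * f i := by
  simp only [sampleCount, Finset.sum_mul]
  rw [Finset.sum_comm]
  simp

theorem sampleCount_nonneg {n N : ℕ} (r : Fin N → Fin n) (i : Fin n) : 0 ≤ sampleCount r i :=
  Finset.sum_nonneg fun k _ => by split_ifs <;> norm_num

namespace IsL1LewisWeights

variable {n d N : ℕ} {A : Matrix (Fin n) (Fin d) ℝ} {w p : Fin n → ℝ}

/-- A diagonal reweighting that dominates the inverse Lewis weights gives an invertible form. -/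
theorem isUnit_det_of_le (h : IsL1LewisWeights A w) {v : Fin n → ℝ}
    (hv : ∀ i, (w i)⁻¹ ≤ v i) : IsUnit (Aᵀ * Matrix.diagonal v * A).det := by
  rw [← Matrix.isUnit_iff_isUnit_det, ← Matrix.mulVec_injective_iff_isUnit]
  have hM := h.isUnit_det
  rw [← Matrix.isUnit_iff_isUnit_det, ← Matrix.mulVec_injective_iff_isUnit] at hM
  refine (injective_iff_map_eq_zero (Matrix.mulVecLin (Aᵀ * Matrix.diagonal v * A))).2 ?_
  intro y hy
  rw [Matrix.mulVecLin_apply] at hy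
  have hq := dotProduct_gram_mulVec A v y y
  rw [hy, dotProduct_zero] at hq
  have hw0 : ∀ i, 0 ≤ (w i)⁻¹ := fun i => inv_nonneg.2 (h.nonneg i)
  have hterm : ∀ i, 0 ≤ v i * (A i ⬝ᵥ y * A i ⬝ᵥ y) := fun i =>
    mul_nonneg ((hw0 i).trans (hv i)) (mul_self_nonneg _)
  have hz : ∀ i, A i ⬝ᵥ y = 0 := by
    intro i
    rcases (h.nonneg i).eq_or_lt with h0 | h0
    · exact h.dotProduct_eq_zero h0.symm y
    · have h1 := (Finset.sum_eq_zero_iff_of_nonneg fun i _ => hterm i).1 hq.symm i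
        (Finset.mem_univ i)
      have h2 : 0 < v i := (inv_pos.2 h0).trans_le (hv i)
      rcases mul_eq_zero.1 h1 with h3 | h3
      · exact absurd h3 h2.ne'
      · exact mul_self_eq_zero.1 h3
  refine hM ?_
  simp only [lewisForm, Matrix.mulVec_zero]
  rw [transpose_mul_diagonal_mul_mulVec]
  simp only [hz, mul_zero]
  exact Matrix.mulVec_zero _

variable {η : ℝ}

/-- The weights of the quadratic form of `A` stacked with a sample of its rows. -/
noncomputable def stackedWeight (w p : Fin n → ℝ) (r : Fin N → Fin n) (i : Fin n) : ℝ :=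
  (w i)⁻¹ * (1 + sampleCount r i / p i)

theorem inv_le_stackedWeight (h : IsL1LewisWeights A w) (hp : ∀ i, 0 ≤ p i)
    (r : Fin N → Fin n) (i : Fin n) : (w i)⁻¹ ≤ stackedWeight w p r i :=
  le_mul_of_one_le_right (inv_nonneg.2 (h.nonneg i))
    (le_add_of_nonneg_right (div_nonneg (sampleCount_nonneg r i) (hp i)))

/-- The variance bound for Khintchine. With `y = Q⁻¹ aᵢ`, the inequality `1 / pⱼ ≤ η / wⱼ` bounds `∑
k, (a_{r k} ⬝ y / p_{r k})²` by `η` times the `Q`-energy of `y`, which is `aᵢᵀ Q⁻¹ aᵢ ≤ wᵢ²`. -/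
theorem sum_sq_le (h : IsL1LewisWeights A w) (hp : ∀ i, 0 ≤ p i) (hη : 0 ≤ η)
    (hwp : ∀ i, w i ≤ η * p i) (r : Fin N → Fin n) (i : Fin n) :
    ∑ k, ((w i)⁻¹ * (A (r k) ⬝ᵥ
      ((Aᵀ * Matrix.diagonal (stackedWeight w p r) * A)⁻¹ *ᵥ A i)) / p (r k)) ^ 2 ≤ η := by
  set v := stackedWeight w p r with hv
  set Q := Aᵀ * Matrix.diagonal v * A with hQ
  have hle := h.inv_le_stackedWeight hp r
  have hdet : IsUnit Q.det := h.isUnit_det_of_le hle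
  set y := Q⁻¹ *ᵥ A i with hy
  have hQy : Q *ᵥ y = A i := by
    rw [hy, Matrix.mulVec_mulVec, Matrix.mul_nonsing_inv _ hdet, Matrix.one_mulVec]
  have hw0 : ∀ i, 0 ≤ (w i)⁻¹ := fun i => inv_nonneg.2 (h.nonneg i)
  have hs : A i ⬝ᵥ y = ∑ j, v j * (A j ⬝ᵥ y) ^ 2 := by
    rw [dotProduct_comm]
    nth_rw 1 [← hQy]
    rw [hQ, dotProduct_gram_mulVec]
    simp only [sq]
  have hs0 : 0 ≤ A i ⬝ᵥ y := by
    rw [hs]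
    exact Finset.sum_nonneg fun j _ => mul_nonneg ((hw0 j).trans (hle j)) (sq_nonneg _)
  have hsw : A i ⬝ᵥ y ≤ w i ^ 2 := by
    have h1 := h.dotProduct_sq_le i y
    have h2 : ∑ j, (w j)⁻¹ * (A j ⬝ᵥ y) ^ 2 ≤ A i ⬝ᵥ y := by
      rw [hs]
      exact Finset.sum_le_sum fun j _ => mul_le_mul_of_nonneg_right (hle j) (sq_nonneg _)
    have h3 := h1.trans (mul_le_mul_of_nonneg_left h2 (sq_nonneg (w i)))
    rcases hs0.eq_or_lt with h0 | h0
    · rw [← h0]; positivity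
    · rw [sq] at h3
      exact le_of_mul_le_mul_right h3 h0
  have hsum : ∑ k, (A (r k) ⬝ᵥ y / p (r k)) ^ 2 ≤ η * (A i ⬝ᵥ y) := by
    rw [sum_comp_eq_sum_sampleCount r (fun j => (A j ⬝ᵥ y / p j) ^ 2), hs, Finset.mul_sum]
    refine Finset.sum_le_sum fun j _ => ?_
    rcases (h.nonneg j).eq_or_lt with h0 | h0
    · rw [h.dotProduct_eq_zero h0.symm y]; simp
    · have hpj : 0 < p j := by
        rcases (hp j).eq_or_lt with h1 | h1
        · have := hwp j; rw [← h1] at this; linarith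
        · exact h1
      have hm := sampleCount_nonneg r j
      have h1 : (p j)⁻¹ ≤ η * (w j)⁻¹ := by
        rw [inv_le_iff_one_le_mul₀ hpj, mul_right_comm, ← div_eq_mul_inv, le_div_iff₀ h0]
        linarith [hwp j]
      have h2 : sampleCount r j / p j * (p j)⁻¹ ≤
          (1 + sampleCount r j / p j) * (η * (w j)⁻¹) := by
        gcongr
        linarith
      calc _ = (sampleCount r j / p j * (p j)⁻¹) * (A j ⬝ᵥ y) ^ 2 := by ring
        _ ≤ (1 + sampleCount r j / p j) * (η * (w j)⁻¹) * (A j ⬝ᵥ y) ^ 2 := by gcongr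
        _ = _ := by rw [hv, stackedWeight]; ring
  have e : ∀ k, ((w i)⁻¹ * (A (r k) ⬝ᵥ y) / p (r k)) ^ 2
      = ((w i)⁻¹) ^ 2 * (A (r k) ⬝ᵥ y / p (r k)) ^ 2 := fun k => by ring
  simp_rw [e]
  rw [← Finset.mul_sum]
  calc _ ≤ ((w i)⁻¹) ^ 2 * (η * w i ^ 2) := by
        gcongr
        exact hsum.trans (mul_le_mul_of_nonneg_left hsw hη)
    _ ≤ η := by
        rcases eq_or_ne (w i) 0 with h0 | h0
        · simp [h0, hη]
        · refine le_of_eq ?_; field_simp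

/-- The Rademacher process of a fixed sample of rows. -/
theorem sum_ciSup_boolSign_pow_le (h : IsL1LewisWeights A w) (hp : ∀ i, 0 ≤ p i) (hη : 0 < η)
    (hη1 : η ≤ 1) (hwp : ∀ i, w i ≤ η * p i) (r : Fin N → Fin n) {q : ℕ} (hq : 1 ≤ q)
    {ι : Type*} [Finite ι] [Nonempty ι] (x : ι → Fin d → ℝ)
    (hx : ∀ i, ∑ j, |A j ⬝ᵥ x i| ≤ 1) {B : ℝ} (hB1 : 1 ≤ B)
    (hB : ∀ i, 1 + ∑ k, |A (r k) ⬝ᵥ x i / p (r k)| ≤ B) :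
    ∑ σ : Fin N → Bool,
        (⨆ i, (∑ k, boolSign (σ k) * (A (r k) ⬝ᵥ x i / p (r k))) ^ (2 * q))
      ≤ B ^ (2 * q) * ((d + N) * (2 ^ N * (2 * (2 * q * Real.exp 1 * η) ^ q))) := by
  set v := stackedWeight w p r with hv
  set Q := Aᵀ * Matrix.diagonal v * A with hQ
  have hle := h.inv_le_stackedWeight hp r
  have hdet : IsUnit Q.det := h.isUnit_det_of_le hle
  have hsymm : Q⁻¹ᵀ = Q⁻¹ := by
    rw [Matrix.transpose_nonsing_inv, hQ]
    simp [Matrix.transpose_mul, Matrix.mul_assoc]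
  set c : (Fin N → Bool) → Fin n → ℝ := fun σ j =>
    ∑ k, boolSign (σ k) * ((w j)⁻¹ * (A (r k) ⬝ᵥ (Q⁻¹ *ᵥ A j)) / p (r k)) with hc
  have hm := sampleCount_nonneg r
  have hev : Even (2 * q) := even_two_mul q
  have hfac : ∀ j, 0 ≤ 1 + sampleCount r j / p j := fun j => by
    have := div_nonneg (hm j) (hp j); linarith
  -- Inserting `Q Q⁻¹` separates `x` from the signs: `c` depends on `σ` but not on `x`.
  have hrep : ∀ σ i, ∑ k, boolSign (σ k) * (A (r k) ⬝ᵥ x i / p (r k))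
      = ∑ j, (1 + sampleCount r j / p j) * (A j ⬝ᵥ x i) * c σ j := by
    intro σ i
    have e1 : ∀ k, A (r k) ⬝ᵥ x i =
        ∑ j, v j * ((A j ⬝ᵥ x i) * (A (r k) ⬝ᵥ (Q⁻¹ *ᵥ A j))) := by
      intro k
      have e2 : ∀ j, A (r k) ⬝ᵥ (Q⁻¹ *ᵥ A j) = A j ⬝ᵥ (Q⁻¹ *ᵥ A (r k)) := by
        intro j
        rw [Matrix.dotProduct_mulVec, ← Matrix.mulVec_transpose, hsymm, dotProduct_comm]
      simp_rw [e2]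
      rw [← dotProduct_gram_mulVec, Matrix.mulVec_mulVec, Matrix.mul_nonsing_inv _ hdet,
        Matrix.one_mulVec, dotProduct_comm]
    simp only [hc, Finset.mul_sum]
    rw [Finset.sum_comm]
    refine Finset.sum_congr rfl fun k _ => ?_
    rw [e1 k, Finset.sum_div, Finset.mul_sum]
    refine Finset.sum_congr rfl fun j _ => ?_
    rw [hv, stackedWeight]; ring
  have hpoint : ∀ σ, (⨆ i, (∑ k, boolSign (σ k) * (A (r k) ⬝ᵥ x i / p (r k))) ^ (2 * q)) ≤
      B ^ (2 * q) * ∑ j, (w j + sampleCount r j) * c σ j ^ (2 * q) := by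
    intro σ
    refine ciSup_le fun i => ?_
    set ω : Fin n → ℝ := fun j => (1 + sampleCount r j / p j) * |A j ⬝ᵥ x i| with hω
    have hω0 : ∀ j, 0 ≤ ω j := fun j => mul_nonneg (hfac j) (abs_nonneg _)
    have hωB : ∑ j, ω j ≤ B := by
      refine le_trans ?_ (hB i)
      rw [sum_comp_eq_sum_sampleCount r (fun j => |A j ⬝ᵥ x i / p j|)]
      refine le_trans (le_of_eq ?_) (add_le_add_left (hx i) _)
      rw [← Finset.sum_add_distrib]
      refine Finset.sum_congr rfl fun j _ => ?_
      rw [abs_div, abs_of_nonneg (hp j), hω]; ring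
    -- This bound on the coefficients is uniform in `x`, so the supremum disappears at the cost of
    -- total mass `d + N`.
    have hωle : ∀ j, ω j ≤ w j + sampleCount r j := by
      intro j
      have h1 : |A j ⬝ᵥ x i| ≤ w j :=
        (h.abs_dotProduct_le j (x i)).trans (mul_le_of_le_one_right (h.nonneg j) (hx i))
      have h2 : w j / p j ≤ 1 := by
        refine div_le_one_of_le₀ ((hwp j).trans ?_) (hp j)
        exact mul_le_of_le_one_left (hp j) hη1
      calc ω j ≤ (1 + sampleCount r j / p j) * w j := mul_le_mul_of_nonneg_left h1 (hfac j)
        _ = w j + sampleCount r j * (w j / p j) := by ring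
        _ ≤ _ := by
            have := mul_le_of_le_one_right (hm j) h2
            linarith
    rw [hrep, ← hev.pow_abs]
    calc _ ≤ (∑ j, ω j * |c σ j|) ^ (2 * q) := by
          refine pow_le_pow_left₀ (abs_nonneg _) ?_ _
          refine (Finset.abs_sum_le_sum_abs _ _).trans (le_of_eq ?_)
          refine Finset.sum_congr rfl fun j _ => ?_
          rw [abs_mul, abs_mul, abs_of_nonneg (hfac j)]
      _ ≤ B ^ (2 * q) * ∑ j, ω j * |c σ j| ^ (2 * q) :=
          sum_mul_pow_le_of_sum_le hω0 (fun j => abs_nonneg _) hB1 hωB (by omega)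
      _ ≤ _ := by
          simp_rw [hev.pow_abs]
          refine mul_le_mul_of_nonneg_left (Finset.sum_le_sum fun j _ => ?_)
            (hev.pow_nonneg _)
          exact mul_le_mul_of_nonneg_right (hωle j) (hev.pow_nonneg _)
  refine (Finset.sum_le_sum fun σ _ => hpoint σ).trans ?_
  rw [← Finset.mul_sum, Finset.sum_comm]
  refine mul_le_mul_of_nonneg_left ?_ (hev.pow_nonneg _)
  have hN : ∑ j, sampleCount r j = N := by
    have := sum_comp_eq_sum_sampleCount r (fun _ => 1)
    simp only [mul_one] at this
    rw [← this]; simp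
  calc _ ≤ ∑ j, (w j + sampleCount r j) * (2 ^ N * (2 * (2 * q * Real.exp 1 * η) ^ q)) := by
        refine Finset.sum_le_sum fun j _ => ?_
        rw [← Finset.mul_sum]
        refine mul_le_mul_of_nonneg_left ?_ (add_nonneg (h.nonneg j) (hm j))
        exact sum_boolSign_pow_le hq _ hη (h.sum_sq_le hp hη.le hwp r j)
    _ = _ := by rw [← Finset.sum_mul, Finset.sum_add_distrib, h.sum_eq, hN]

end IsL1LewisWeights

/-! ### Moment recursion and tail bound. -/

/-- The deviation of the sampled `ℓ₁` norm of `A x` from the true one. -/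
noncomputable def l1Deviation {n d N : ℕ} (A : Matrix (Fin n) (Fin d) ℝ) (p : Fin n → ℝ)
    (r : Fin N → Fin n) (x : Fin d → ℝ) : ℝ :=
  ∑ k, |A (r k) ⬝ᵥ x / p (r k)| - ∑ j, |A j ⬝ᵥ x|

namespace IsL1LewisWeights

variable {n d N : ℕ} {A : Matrix (Fin n) (Fin d) ℝ} {w p : Fin n → ℝ} {η : ℝ}

theorem mul_abs_div_eq (h : IsL1LewisWeights A w) (hp : ∀ i, 0 ≤ p i)
    (hwp : ∀ i, w i ≤ η * p i) (x : Fin d → ℝ) (j : Fin n) :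
    p j * |A j ⬝ᵥ x / p j| = |A j ⬝ᵥ x| := by
  rcases (hp j).eq_or_lt with h0 | h0
  · have h1 : w j = 0 := le_antisymm (by have := hwp j; rwa [← h0, mul_zero] at this) (h.nonneg j)
    rw [h.dotProduct_eq_zero h1 x]; simp
  · rw [abs_div, abs_of_pos h0, mul_div_cancel₀ _ h0.ne']

/-- The moment appears on both sides because the bound for a fixed sample involves its sampled norm,
which the deviation itself controls. -/
theorem l1Deviation_moment_le (h : IsL1LewisWeights A w) (hN : 1 ≤ N) (hp : ∀ i, 0 ≤ p i)
    (hpN : ∑ i, p i = N) (hη : 0 < η) (hη1 : η ≤ 1) (hwp : ∀ i, w i ≤ η * p i)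
    {q : ℕ} (hq : 1 ≤ q) {ι : Type*} [Finite ι] [Nonempty ι] (x : ι → Fin d → ℝ)
    (hx : ∀ i, ∑ j, |A j ⬝ᵥ x i| ≤ 1) :
    ∑ r : Fin N → Fin n, (∏ k, p (r k) / N) * ⨆ i, l1Deviation A p r (x i) ^ (2 * q)
      ≤ 4 * (d + N) * (32 * q * Real.exp 1 * η) ^ q *
        (4 ^ q + ∑ r : Fin N → Fin n,
          (∏ k, p (r k) / N) * ⨆ i, l1Deviation A p r (x i) ^ (2 * q)) := by
  have hbd : ∀ F : ι → ℝ, BddAbove (Set.range F) := fun F => (Set.finite_range F).bddAbove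
  have hev : Even (2 * q) := even_two_mul q
  have hN0 : (0 : ℝ) < N := by exact_mod_cast hN
  set P : Fin n → ℝ := fun j => p j / N with hPdef
  have hP0 : ∀ j, 0 ≤ P j := fun j => div_nonneg (hp j) hN0.le
  have hP1 : ∑ j, P j = 1 := by rw [← Finset.sum_div, hpN, div_self hN0.ne']
  have hρ : ∀ r : Fin N → Fin n, 0 ≤ ∏ k, P (r k) := fun r => Finset.prod_nonneg fun k _ => hP0 _
  have hmean : ∀ i, N * ∑ j, P j * |A j ⬝ᵥ x i / p j| = ∑ j, |A j ⬝ᵥ x i| := by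
    intro i
    rw [Finset.mul_sum]
    refine Finset.sum_congr rfl fun j _ => ?_
    rw [← h.mul_abs_div_eq hp hwp, hPdef]
    field_simp
  set K : ℝ := (d + N) * (2 ^ N * (2 * (2 * q * Real.exp 1 * η) ^ q)) with hK
  have hK0 : 0 ≤ K := by positivity
  set M : (Fin N → Fin n) → ℝ := fun r => ⨆ i, l1Deviation A p r (x i) ^ (2 * q) with hM
  have hsym := symmetrization (N := N) hq hP0 hP1 (fun (i : ι) j => |A j ⬝ᵥ x i / p j|)
  simp only [hmean] at hsym
  have hrad : ∀ r : Fin N → Fin n,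
      ∑ σ : Fin N → Bool, (⨆ i, (∑ k, boolSign (σ k) * |A (r k) ⬝ᵥ x i / p (r k)|) ^ (2 * q))
        ≤ 2 * (2 ^ (2 * q) * (2 ^ (2 * q) + M r) * K) := by
    intro r
    refine (sum_ciSup_abs_pow_le hq fun k i => A (r k) ⬝ᵥ x i / p (r k)).trans ?_
    obtain ⟨i₀, hi₀⟩ := exists_eq_ciSup_of_finite (f := fun i => |l1Deviation A p r (x i)|)
    set Y := |l1Deviation A p r (x i₀)| with hY
    have hYle : ∀ i, |l1Deviation A p r (x i)| ≤ Y := fun i =>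
      (le_ciSup (hbd fun i => |l1Deviation A p r (x i)|) i).trans hi₀.ge
    have hY0 : 0 ≤ Y := abs_nonneg _
    -- `B = 2 + Y`: 1 for `‖Ax‖₁`, and `1 + Y` for the sampled norm.
    have h1 := h.sum_ciSup_boolSign_pow_le hp hη hη1 hwp r hq x hx (B := 2 + Y) (by linarith)
      (fun i => by
        have h2 := (le_abs_self _).trans (hYle i)
        rw [l1Deviation] at h2
        linarith [hx i])
    refine mul_le_mul_of_nonneg_left (h1.trans ?_) zero_le_two
    refine mul_le_mul_of_nonneg_right ?_ hK0
    refine (add_pow_le zero_le_two hY0 (2 * q)).trans ?_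
    have hYM : Y ^ (2 * q) ≤ M r := by
      rw [hY, hev.pow_abs]
      exact le_ciSup (hbd fun i => l1Deviation A p r (x i) ^ (2 * q)) i₀
    have hYn : 0 ≤ Y ^ (2 * q) := by positivity
    gcongr
    · norm_num
    · omega
  have hM0 : 2 ^ N * ∑ r : Fin N → Fin n, (∏ k, P (r k)) * M r ≤
      2 ^ (2 * q) * (2 * (2 ^ (2 * q) * K) *
        (2 ^ (2 * q) + ∑ r : Fin N → Fin n, (∏ k, P (r k)) * M r)) := by
    refine hsym.trans (mul_le_mul_of_nonneg_left ?_ (by positivity))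
    calc _ ≤ ∑ r : Fin N → Fin n,
          (∏ k, P (r k)) * (2 * (2 ^ (2 * q) * (2 ^ (2 * q) + M r) * K)) :=
          Finset.sum_le_sum fun r _ => mul_le_mul_of_nonneg_left (hrad r) (hρ r)
      _ = 2 * (2 ^ (2 * q) * K) * (2 ^ (2 * q) * ∑ r : Fin N → Fin n, (∏ k, P (r k)) +
            ∑ r : Fin N → Fin n, (∏ k, P (r k)) * M r) := by
          rw [Finset.mul_sum, ← Finset.sum_add_distrib, Finset.mul_sum]
          exact Finset.sum_congr rfl fun r _ => by ring
      _ = _ := by rw [sum_prod_eq_one hP1, mul_one]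
  refine le_of_mul_le_mul_left (hM0.trans (le_of_eq ?_)) (by positivity : (0 : ℝ) < 2 ^ N)
  have e : (32 * q * Real.exp 1 * η : ℝ) ^ q
      = 2 ^ (2 * q) * 2 ^ (2 * q) * (2 * q * Real.exp 1 * η) ^ q := by
    rw [pow_mul, ← mul_pow, ← mul_pow]; congr 1; ring
  have e2 : (2 : ℝ) ^ (2 * q) = 4 ^ q := by rw [pow_mul]; norm_num
  rw [e, hK, e2]
  ring

/-- Tail bound for the uniform deviation of the sampled `ℓ₁` norm. -/
theorem sum_prod_l1Deviation_le (h : IsL1LewisWeights A w) (hN : 1 ≤ N) (hp : ∀ i, 0 ≤ p i)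
    (hpN : ∑ i, p i = N) (hη : 0 < η) (hη1 : η ≤ 1) (hwp : ∀ i, w i ≤ η * p i)
    {q : ℕ} (hq : 1 ≤ q) (hκ : 4 * (d + N) * (32 * q * Real.exp 1 * η) ^ q ≤ 1 / 2)
    {δ : ℝ} (hδ : 0 < δ) (s : Finset (Fin N → Fin n))
    (hs : ∀ r ∈ s, ∃ x : Fin d → ℝ, ∑ j, |A j ⬝ᵥ x| ≤ 1 ∧ δ ≤ |l1Deviation A p r x|) :
    ∑ r ∈ s, ∏ k, p (r k) / N ≤
      8 * (d + N) * (128 * q * Real.exp 1 * η / δ ^ 2) ^ q := by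
  have hN0 : (0 : ℝ) < N := by exact_mod_cast hN
  have hne : Nonempty (Fin n) := by
    by_contra hcon
    rw [not_nonempty_iff] at hcon
    rw [Finset.univ_eq_empty, Finset.sum_empty] at hpN
    linarith
  -- One witness per sample sequence suffices, so the supremum runs over a finite family indexed by
  -- the sequences and no net is needed.
  have hex : ∀ r : Fin N → Fin n, ∃ x : Fin d → ℝ, ∑ j, |A j ⬝ᵥ x| ≤ 1 ∧
      (r ∈ s → δ ≤ |l1Deviation A p r x|) := by
    intro r
    by_cases hr : r ∈ s
    · obtain ⟨x, hx1, hx2⟩ := hs r hr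
      exact ⟨x, hx1, fun _ => hx2⟩
    · exact ⟨0, by simp, fun h' => absurd h' hr⟩
  choose x hx1 hx2 using hex
  have hev : Even (2 * q) := even_two_mul q
  have hρ : ∀ r : Fin N → Fin n, 0 ≤ ∏ k, p (r k) / N := fun r =>
    Finset.prod_nonneg fun k _ => div_nonneg (hp _) hN0.le
  have hmom := h.l1Deviation_moment_le hN hp hpN hη hη1 hwp hq x hx1
  set V := ∑ r : Fin N → Fin n, (∏ k, p (r k) / N) * ⨆ i, l1Deviation A p r (x i) ^ (2 * q)
    with hV
  have hle : ∀ r i : Fin N → Fin n, l1Deviation A p r (x i) ^ (2 * q) ≤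
      ⨆ i, l1Deviation A p r (x i) ^ (2 * q) := fun r i =>
    le_ciSup (f := fun i => l1Deviation A p r (x i) ^ (2 * q)) (Set.finite_range _).bddAbove i
  have hsup0 : ∀ r : Fin N → Fin n, 0 ≤ ⨆ i, l1Deviation A p r (x i) ^ (2 * q) := fun r =>
    (hev.pow_nonneg _).trans (hle r r)
  have hV0 : 0 ≤ V := Finset.sum_nonneg fun r _ => mul_nonneg (hρ r) (hsup0 r)
  have hmarkov : δ ^ (2 * q) * ∑ r ∈ s, ∏ k, p (r k) / N ≤ V := by
    rw [Finset.mul_sum]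
    calc _ ≤ ∑ r ∈ s, (∏ k, p (r k) / N) * ⨆ i, l1Deviation A p r (x i) ^ (2 * q) := by
          refine Finset.sum_le_sum fun r hr => ?_
          rw [mul_comm]
          refine mul_le_mul_of_nonneg_left ?_ (hρ r)
          refine le_trans ?_ (hle r r)
          rw [← hev.pow_abs (l1Deviation A p r (x r))]
          exact pow_le_pow_left₀ hδ.le (hx2 r hr) _
      _ ≤ V := Finset.sum_le_univ_sum_of_nonneg fun r => mul_nonneg (hρ r) (hsup0 r)
  set κ := 4 * (d + N) * (32 * q * Real.exp 1 * η) ^ q with hκdef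
  -- Since `κ ≤ 1/2`, the term `κ V` is absorbed on the left.
  have hV2 : V ≤ 2 * κ * 4 ^ q := by nlinarith
  have hfin : ∑ r ∈ s, ∏ k, p (r k) / N ≤ 2 * κ * 4 ^ q / δ ^ (2 * q) := by
    rw [le_div_iff₀ (by positivity), mul_comm]
    exact hmarkov.trans hV2
  refine hfin.trans (le_of_eq ?_)
  have e : (128 * q * Real.exp 1 * η / δ ^ 2 : ℝ) ^ q
      = (32 * q * Real.exp 1 * η) ^ q * 4 ^ q / δ ^ (2 * q) := by
    rw [pow_mul, ← mul_pow, ← div_pow]; congr 1; ring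
  rw [e, hκdef]; ring

end IsL1LewisWeights

/-! ### From deviations to the sampling matrix and its law. -/

theorem l1norm_eq_sum_abs {m : ℕ} (v : Fin m → ℝ) : l1norm v = ∑ i, |v i| := by
  rw [l1norm, PiLp.norm_eq_of_L1]; rfl

theorem l1norm_samplingMatrix_mul_mulVec {n d N : ℕ} (p : Fin n → ℝ) (r : Fin N → Fin n)
    (A : Matrix (Fin n) (Fin d) ℝ) (x : Fin d → ℝ) :
    l1norm ((samplingMatrix p r * A) *ᵥ x) = ∑ k, |A (r k) ⬝ᵥ x / p (r k)| := by
  rw [l1norm_eq_sum_abs, ← Matrix.mulVec_mulVec]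
  refine Finset.sum_congr rfl fun k _ => ?_
  congr 1
  change Pi.single (r k) (1 / p (r k)) ⬝ᵥ (A *ᵥ x) = _
  rw [single_dotProduct, Matrix.mulVec]
  ring

theorem l1norm_mulVec {n d : ℕ} (A : Matrix (Fin n) (Fin d) ℝ) (x : Fin d → ℝ) :
    l1norm (A *ᵥ x) = ∑ j, |A j ⬝ᵥ x| := l1norm_eq_sum_abs _

theorem approxFactor_one_add {ε s t : ℝ} (hε : 0 < ε) (hε1 : ε ≤ 1) (ht : 0 ≤ t)
    (h : |s - t| ≤ ε / 2 * t) : ApproxFactor (1 + ε) s t := by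
  obtain ⟨h1, h2⟩ := abs_le.1 h
  constructor
  · rw [one_div, inv_mul_le_iff₀ (by linarith)]
    nlinarith
  · have h3 : (1 - ε / 2) * t ≤ s := by linarith
    have h4 : (1 + ε) * ((1 - ε / 2) * t) ≤ (1 + ε) * s :=
      mul_le_mul_of_nonneg_left h3 (by linarith)
    -- `(1 + ε)(1 - ε/2) = 1 + ε(1 - ε)/2 ≥ 1`, which is why the tolerance is `ε / 2`.
    have h5 : 0 ≤ ε * (1 - ε) * t := mul_nonneg (mul_nonneg hε.le (by linarith)) ht
    nlinarith

/-- The deviation is homogeneous, so a violating `x` can be rescaled to `‖Ax‖₁ = 1`; if `Ax = 0` the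
deviation vanishes and nothing is violated. -/
theorem exists_l1Deviation_of_not_preservesL1 {n d N : ℕ} {A : Matrix (Fin n) (Fin d) ℝ}
    {p : Fin n → ℝ} {r : Fin N → Fin n} {ε : ℝ} (hε : 0 < ε) (hε1 : ε ≤ 1)
    (h : ¬ PreservesL1 ε (samplingMatrix p r) A) :
    ∃ x : Fin d → ℝ, ∑ j, |A j ⬝ᵥ x| ≤ 1 ∧ ε / 2 ≤ |l1Deviation A p r x| := by
  rw [PreservesL1, not_forall] at h
  obtain ⟨x, hx⟩ := h
  rw [l1norm_samplingMatrix_mul_mulVec, l1norm_mulVec] at hx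
  have hnn : ∀ j ∈ Finset.univ, 0 ≤ |A j ⬝ᵥ x| := fun j _ => abs_nonneg _
  set t := ∑ j, |A j ⬝ᵥ x| with ht
  have ht0 : 0 ≤ t := Finset.sum_nonneg hnn
  have hdev : ε / 2 * t < |l1Deviation A p r x| :=
    lt_of_not_ge fun hle => hx (approxFactor_one_add hε hε1 ht0 hle)
  have htpos : 0 < t := by
    refine ht0.lt_of_ne fun h0 => ?_
    have hz : ∀ j, A j ⬝ᵥ x = 0 := fun j =>
      abs_eq_zero.1 ((Finset.sum_eq_zero_iff_of_nonneg hnn).1 h0.symm j (Finset.mem_univ j))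
    rw [← h0, mul_zero, l1Deviation] at hdev
    simp [hz] at hdev
  have hinv : 0 ≤ t⁻¹ := inv_nonneg.2 ht0
  refine ⟨t⁻¹ • x, ?_, ?_⟩
  · simp only [dotProduct_smul, smul_eq_mul, abs_mul, abs_of_nonneg hinv]
    rw [← Finset.mul_sum, ← ht, inv_mul_cancel₀ htpos.ne']
  · have e : l1Deviation A p r (t⁻¹ • x) = t⁻¹ * l1Deviation A p r x := by
      simp only [l1Deviation, dotProduct_smul, smul_eq_mul, mul_div_assoc, abs_mul,
        abs_of_nonneg hinv, mul_sub, Finset.mul_sum]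
    rw [e, abs_mul, abs_of_nonneg hinv, inv_mul_eq_div, le_div_iff₀ htpos]
    exact hdev.le

theorem IsRowSampling.one_sub_sum_le {Ω : Type*} [MeasurableSpace Ω] {μ : Measure Ω}
    [IsProbabilityMeasure μ] {n N : ℕ} {p : Fin n → ℝ} {idx : Fin N → Ω → Fin n}
    (h : IsRowSampling μ p idx) (hp : ∀ i, 0 ≤ p i) (T : (Fin N → Fin n) → Prop)
    (s : Finset (Fin N → Fin n)) (hs : ∀ r, ¬ T r → r ∈ s) :
    1 - ∑ r ∈ s, ∏ k, p (r k) / N ≤ μ.real {ω | T fun k => idx k ω} := by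
  have hone : ∀ r : Fin N → Fin n,
      μ.real {ω | (fun k => idx k ω) = r} = ∏ k, p (r k) / N := by
    intro r
    have h1 := h.indep.measure_inter_preimage_eq_mul Finset.univ (sets := fun k => {r k})
      (fun k _ => MeasurableSet.singleton _)
    have e : {ω | (fun k => idx k ω) = r} = ⋂ k ∈ Finset.univ, idx k ⁻¹' {r k} := by
      ext ω; simp [funext_iff]
    rw [Measure.real, e, h1, ENNReal.toReal_prod]
    refine Finset.prod_congr rfl fun k _ => ?_
    have h2 : μ (idx k ⁻¹' {r k}) = ENNReal.ofReal (p (r k) / N) := h.law k (r k)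
    rw [h2, ENNReal.toReal_ofReal (div_nonneg (hp _) (Nat.cast_nonneg _))]
  have hcover : (Set.univ : Set Ω) ⊆
      {ω | T fun k => idx k ω} ∪ ⋃ r ∈ s, {ω | (fun k => idx k ω) = r} := by
    intro ω _
    by_cases hT : T fun k => idx k ω
    · exact Or.inl hT
    · exact Or.inr (Set.mem_biUnion (hs _ hT) rfl)
  have h1 : (1 : ℝ) ≤ μ.real {ω | T fun k => idx k ω} +
      μ.real (⋃ r ∈ s, {ω | (fun k => idx k ω) = r}) := by
    rw [← probReal_univ (μ := μ)]
    exact (measureReal_mono hcover).trans (measureReal_union_le _ _)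
  have h2 : μ.real (⋃ r ∈ s, {ω | (fun k => idx k ω) = r}) ≤ ∑ r ∈ s, ∏ k, p (r k) / N :=
    (measureReal_biUnion_finset_le s _).trans (le_of_eq (Finset.sum_congr rfl fun r _ => hone r))
  linarith

/-! ### Choice of parameters for the first claim. -/

/-- The oversampling constant for failure probability `N ^ (-c)`. -/
noncomputable def samplingConstant (c : ℝ) : ℝ := 512 * Real.exp 1 ^ 2 * (c + 7)

theorem samplingConstant_pos {c : ℝ} (hc : 0 < c) : 0 < samplingConstant c := by
  unfold samplingConstant; positivity

theorem one_half_lt_log_natCast {N : ℕ} (hN : 2 ≤ N) : 1 / 2 < Real.log N := by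
  have h1 : Real.log 2 ≤ Real.log N := Real.log_le_log two_pos (by exact_mod_cast hN)
  linarith [Real.log_two_gt_d9]

theorem IsL1LewisWeights.one_sub_rpow_le {n d N : ℕ} {A : Matrix (Fin n) (Fin d) ℝ}
    {w p : Fin n → ℝ} {ε c : ℝ} (hc : 0 < c) (h : IsL1LewisWeights A w) (hε : 0 < ε)
    (hε1 : ε ≤ 1) (hN : 1 ≤ N) (hpN : ∑ i, p i = (N : ℝ))
    (hwp : ∀ i, samplingConstant c * w i * Real.log (N : ℝ) * (ε ^ 2)⁻¹ ≤ p i)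
    {Ω : Type*} [MeasurableSpace Ω] (μ : Measure Ω) [IsProbabilityMeasure μ]
    {idx : Fin N → Ω → Fin n} (hidx : IsRowSampling μ p idx) :
    1 - (N : ℝ) ^ (-c) ≤
      μ.real {ω | PreservesL1 ε (samplingMatrix p (fun k => idx k ω)) A} := by
  classical
  -- For `N = 1` the claimed lower bound is 0; otherwise `log N > 1/2`.
  rcases hN.eq_or_lt with rfl | hN2
  · simp
  replace hN2 : 2 ≤ N := hN2
  set L := Real.log (N : ℝ) with hL
  have hL2 : 1 / 2 < L := one_half_lt_log_natCast hN2
  have hL0 : 0 < L := by linarith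
  have hC := samplingConstant_pos hc
  set C := samplingConstant c with hCdef
  have hp : ∀ i, 0 ≤ p i := fun i => by
    refine le_trans ?_ (hwp i)
    have := h.nonneg i
    positivity
  have he : 1 < Real.exp 1 := Real.one_lt_exp_iff.2 one_pos
  have hCL : 512 * Real.exp 1 ^ 2 * (c + 7) * L = C * L := rfl
  set η := ε ^ 2 / (C * L) with hη
  have hη0 : 0 < η := by positivity
  have hη1 : η ≤ 1 := by
    rw [hη, div_le_one (by positivity), ← hCL]
    have h1 : ε ^ 2 ≤ 1 := pow_le_one₀ hε.le hε1
    have h2 : 1 ≤ Real.exp 1 ^ 2 := one_le_pow₀ he.le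
    have h3 : 1 ≤ (c + 7) * L := by nlinarith
    have h4 : 1 ≤ Real.exp 1 ^ 2 * ((c + 7) * L) := one_le_mul_of_one_le_of_one_le h2 h3
    linarith
  have hwη : ∀ i, w i ≤ η * p i := fun i => by
    have h1 := mul_le_mul_of_nonneg_left (hwp i) hη0.le
    refine le_trans (le_of_eq ?_) h1
    rw [hη]; field_simp
  have hdN : (d : ℝ) ≤ N := by
    rw [← h.sum_eq, ← hpN]
    exact Finset.sum_le_sum fun i _ => (hwη i).trans (mul_le_of_le_one_left (hp i) hη1)
  -- Then `e ^ (-q) ≤ N ^ (-c - 5)`, and `N ^ 5` pays for the prefactor `8 (d + N) ≤ 16 N`. Rounding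
  -- up costs less than `2 L`, hence the `c + 7` in the constant.
  set q := ⌈(c + 5) * L⌉₊ with hq
  have hq0 : 0 < (c + 5) * L := by positivity
  have hq1 : 1 ≤ q := Nat.one_le_iff_ne_zero.2 (Nat.ceil_pos.2 hq0).ne'
  have hqL : (q : ℝ) ≤ (c + 7) * L := by
    have := Nat.ceil_lt_add_one hq0.le
    nlinarith
  have hbase : 512 * q * Real.exp 1 / (C * L) ≤ Real.exp (-1) := by
    rw [div_le_iff₀ (by positivity), ← hCL, Real.exp_neg]
    have : (Real.exp 1)⁻¹ * (512 * Real.exp 1 ^ 2 * (c + 7) * L)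
        = 512 * Real.exp 1 * ((c + 7) * L) := by field_simp
    rw [this]
    nlinarith [Real.exp_pos 1]
  have hN0 : (0 : ℝ) < N := by exact_mod_cast hN
  have hNr : (2 : ℝ) ≤ N := by exact_mod_cast hN2
  have hexpq : Real.exp (-1) ^ q ≤ (N : ℝ) ^ (-c) * ((N : ℝ) ^ 5)⁻¹ := by
    have h1 : (c + 5) * L ≤ q := Nat.le_ceil _
    rw [← Real.exp_nat_mul, Real.rpow_def_of_pos hN0, ← Real.exp_log (pow_pos hN0 5),
      ← Real.exp_neg, ← Real.exp_add, Real.log_pow, ← hL]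
    refine Real.exp_le_exp.2 ?_
    push_cast
    linarith
  have hN5 : 16 * (N : ℝ) ≤ N ^ 5 := by
    have : (2 : ℝ) ^ 4 ≤ N ^ 4 := pow_le_pow_left₀ zero_le_two hNr 4
    nlinarith
  have hNc : (N : ℝ) ^ (-c) ≤ 1 :=
    Real.rpow_le_one_of_one_le_of_nonpos (by linarith) (by linarith)
  have hNc0 : 0 < (N : ℝ) ^ (-c) := Real.rpow_pos_of_pos hN0 _
  have hsmall : 8 * (d + N) * Real.exp (-1) ^ q ≤ (N : ℝ) ^ (-c) := by
    calc _ ≤ (N : ℝ) ^ 5 * ((N : ℝ) ^ (-c) * ((N : ℝ) ^ 5)⁻¹) := by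
          gcongr
          linarith
      _ = _ := by field_simp
  have hbase2 : 128 * q * Real.exp 1 * η / (ε / 2) ^ 2 ≤ Real.exp (-1) := by
    refine le_trans (le_of_eq ?_) hbase
    rw [hη]; field_simp; norm_num
  have hbase1 : 32 * q * Real.exp 1 * η ≤ Real.exp (-1) := by
    refine le_trans ?_ hbase2
    rw [le_div_iff₀ (by positivity)]
    have h1 : (ε / 2) ^ 2 ≤ 1 := pow_le_one₀ (by positivity) (by linarith)
    have h2 : 0 ≤ 32 * q * Real.exp 1 * η := by positivity
    nlinarith
  have hκ : 4 * (d + N) * (32 * q * Real.exp 1 * η) ^ q ≤ 1 / 2 := by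
    calc _ ≤ 4 * (d + N) * Real.exp (-1) ^ q := by gcongr
      _ ≤ 1 / 2 := by linarith
  set s : Finset (Fin N → Fin n) :=
    Finset.univ.filter fun r => ¬ PreservesL1 ε (samplingMatrix p r) A with hs
  have hbad := h.sum_prod_l1Deviation_le hN hp hpN hη0 hη1 hwη hq1 hκ (half_pos hε) s
    fun r hr => exists_l1Deviation_of_not_preservesL1 hε hε1 (Finset.mem_filter.1 hr).2
  have hbad2 : ∑ r ∈ s, ∏ k, p (r k) / N ≤ (N : ℝ) ^ (-c) := by
    refine hbad.trans (le_trans ?_ hsmall)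
    gcongr
  have := hidx.one_sub_sum_le hp (fun r => PreservesL1 ε (samplingMatrix p r) A) s
    fun r hr => Finset.mem_filter.2 ⟨Finset.mem_univ _, hr⟩
  linarith

/-! ### Sample size for the second claim. -/

theorem Real.log_le_two_mul_sqrt {z : ℝ} (hz : 0 < z) : Real.log z ≤ 2 * √z := by
  have h := Real.log_le_self (Real.sqrt_nonneg z)
  rw [Real.log_sqrt hz.le] at h
  linarith

/-- A lower bound `N ≥ K d log (d / ε) / ε²` implies `N ≥ β (d / ε²) log N`. -/
theorem mul_log_le_of_sample_size {β d ε N : ℝ} (hβ : 0 < β) (hd : 1 ≤ d) (hε : 0 < ε)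
    (hdε : 2 ≤ d / ε)
    (hN : (32 * β ^ 2 + 4 * β) * d * Real.log (d / ε) * (ε ^ 2)⁻¹ ≤ N) :
    β * d * Real.log N * (ε ^ 2)⁻¹ ≤ N := by
  set L := Real.log (d / ε) with hL
  have hL2 : 1 / 2 < L := by
    have := Real.log_le_log two_pos hdε
    linarith [Real.log_two_gt_d9]
  set D := d * (ε ^ 2)⁻¹ with hD
  have hD0 : 0 < D := by positivity
  have hKN : (32 * β ^ 2 + 4 * β) * L * D ≤ N := by
    refine le_trans (le_of_eq ?_) hN
    rw [hD]; ring
  have hN0 : 0 < N := lt_of_lt_of_le (by positivity) hKN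
  -- `log N = log z + log D`, with `log z ≤ 2 √z` and `log D ≤ 2 L`. The term `32 β²` gives `√z ≥ 4
  -- β`, and `4 β` gives `β L ≤ z / 4`, so each half of `β log N` is at most `z / 2`.
  set z := N / D with hz
  have hz0 : 0 < z := by positivity
  have hzK : (32 * β ^ 2 + 4 * β) * L ≤ z := (le_div_iff₀ hD0).2 hKN
  have hNz : N = z * D := by rw [hz, div_mul_cancel₀ _ hD0.ne']
  have hlogD : Real.log D ≤ 2 * L := by
    have h1 : D ≤ (d / ε) ^ 2 := by
      rw [hD, div_pow, div_eq_mul_inv]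
      gcongr
      nlinarith
    have h2 := Real.log_le_log hD0 h1
    rwa [Real.log_pow] at h2
  have hlogN : Real.log N ≤ 2 * √z + 2 * L := by
    rw [hNz, Real.log_mul hz0.ne' hD0.ne']
    exact add_le_add (Real.log_le_two_mul_sqrt hz0) hlogD
  have hsq : 4 * β ≤ √z := by
    apply Real.le_sqrt_of_sq_le
    nlinarith
  have h1 : β * √z ≤ z / 4 := by
    have := Real.mul_self_sqrt hz0.le
    nlinarith [Real.sqrt_nonneg z]
  have h2 : β * L ≤ z / 4 := by nlinarith
  have h3 : β * Real.log N ≤ z := by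
    have := mul_le_mul_of_nonneg_left hlogN hβ.le
    linarith
  calc β * d * Real.log N * (ε ^ 2)⁻¹ = β * Real.log N * D := by rw [hD]; ring
    _ ≤ z * D := mul_le_mul_of_nonneg_right h3 hD0.le
    _ = N := hNz.symm

theorem ApproxFactor.le_mul {α x y : ℝ} (hα : 0 < α) (h : ApproxFactor α x y) : x ≤ α * y := by
  have := h.1
  rwa [one_div, inv_mul_le_iff₀ hα] at this

theorem theorem2 :
    (∀ c : ℝ, 0 < c → ∃ Cs : ℝ, 0 < Cs ∧
      ∀ (n d N : ℕ) (A : Matrix (Fin n) (Fin d) ℝ) (w p : Fin n → ℝ) (ε : ℝ),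
        IsL1LewisWeights A w → 0 < ε → ε ≤ 1 → 1 ≤ N →
        ∑ i, p i = (N : ℝ) →
        (∀ i, Cs * w i * Real.log (N : ℝ) * (ε ^ 2)⁻¹ ≤ p i) →
        ∀ (Ω : Type*) [MeasurableSpace Ω] (μ : Measure Ω) [IsProbabilityMeasure μ]
          (idx : Fin N → Ω → Fin n),
          IsRowSampling μ p idx →
          1 - (N : ℝ) ^ (-c) ≤
            μ.real {ω | PreservesL1 ε (samplingMatrix p (fun k => idx k ω)) A}) ∧
    (∀ c : ℝ, 0 < c → ∀ α : ℝ, 1 ≤ α → ∃ K : ℝ, 0 < K ∧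
      ∀ (n d N : ℕ) (A : Matrix (Fin n) (Fin d) ℝ) (w w' : Fin n → ℝ) (ε : ℝ),
        IsL1LewisWeights A w → (∀ i, ApproxFactor α (w i) (w' i)) →
        0 < ε → ε ≤ 1 → 2 ≤ (d : ℝ) / ε →
        K * (d : ℝ) * Real.log ((d : ℝ) / ε) * (ε ^ 2)⁻¹ ≤ (N : ℝ) →
        ∀ (Ω : Type*) [MeasurableSpace Ω] (μ : Measure Ω) [IsProbabilityMeasure μ]
          (idx : Fin N → Ω → Fin n),
          IsRowSampling μ (fun i => (N : ℝ) * w' i / ∑ j, w' j) idx →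
          1 - (N : ℝ) ^ (-c) ≤
            μ.real {ω | PreservesL1 ε
              (samplingMatrix (fun i => (N : ℝ) * w' i / ∑ j, w' j) (fun k => idx k ω)) A}) := by
  refine ⟨fun c hc => ⟨samplingConstant c, samplingConstant_pos hc, ?_⟩,
    fun c hc α hα => ⟨32 * (samplingConstant c * α ^ 2) ^ 2 + 4 * (samplingConstant c * α ^ 2),
      ?_, ?_⟩⟩
  · intro n d N A w p ε h hε hε1 hN hpN hwp Ω _ μ _ idx hidx
    exact h.one_sub_rpow_le hc hε hε1 hN hpN hwp μ hidx
  · have := samplingConstant_pos hc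
    positivity
  · intro n d N A w w' ε h hw hε hε1 hdε hN Ω _ μ _ idx hidx
    have hC := samplingConstant_pos hc
    set C := samplingConstant c
    have hα0 : 0 < α := zero_lt_one.trans_le hα
    have hd1 : 1 ≤ d := by
      rcases Nat.eq_zero_or_pos d with h0 | h0
      · rw [h0, Nat.cast_zero, zero_div] at hdε; linarith
      · exact h0
    have hd : (1 : ℝ) ≤ d := by exact_mod_cast hd1
    have hL : 0 < Real.log ((d : ℝ) / ε) := Real.log_pos (by linarith)
    have hN0 : (0 : ℝ) < N := lt_of_lt_of_le (by positivity) hN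
    have hN1 : 1 ≤ N := Nat.cast_pos.1 hN0
    have hle : ∀ i, w i ≤ α * w' i := fun i => (hw i).le_mul hα0
    have hW : ∑ j, w' j ≤ α * d := by
      rw [← h.sum_eq, Finset.mul_sum]
      exact Finset.sum_le_sum fun i _ => (hw i).2
    have hW0 : 0 < ∑ j, w' j := by
      have h1 : (d : ℝ) ≤ α * ∑ j, w' j := by
        rw [← h.sum_eq, Finset.mul_sum]
        exact Finset.sum_le_sum fun i _ => hle i
      exact pos_of_mul_pos_right (by linarith) hα0.le
    refine h.one_sub_rpow_le hc hε hε1 hN1 ?_ (fun i => ?_) μ hidx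
    · rw [← Finset.sum_div, ← Finset.mul_sum, mul_div_assoc, div_self hW0.ne', mul_one]
    -- One factor `α` comes from `w ≤ α w'`, the other from `∑ w' ≤ α d`.
    · have hsize := mul_log_le_of_sample_size (β := C * α ^ 2) (by positivity) hd hε hdε hN
      have hlogN : 0 ≤ Real.log (N : ℝ) := Real.log_natCast_nonneg N
      have hw'0 : 0 ≤ w' i := by
        have := (h.nonneg i).trans (hle i)
        exact nonneg_of_mul_nonneg_right this hα0
      rw [le_div_iff₀ hW0]
      calc C * w i * Real.log N * (ε ^ 2)⁻¹ * ∑ j, w' j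
          ≤ C * (α * w' i) * Real.log N * (ε ^ 2)⁻¹ * (α * d) := by
            gcongr
            exact hle i
        _ = C * α ^ 2 * d * Real.log N * (ε ^ 2)⁻¹ * w' i := by ring
        _ ≤ N * w' i := mul_le_mul_of_nonneg_right hsize hw'0
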